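/- Let $H_0$ be a separable infinite-dimensional complex Hilbert space, $H\subset H_0$ a closed subspace with orthogonal projection $P:H_0\to H$, $T$ a closed, densely defined linear operator in $H$ with resolvent set $\rho(T)$, spectrum $\sigma(T)=\mathbb{C}\setminus\rho(T)$ and Hilbert space adjoint $T^*$, and let $\varepsilon>0$. For $\Omega\subset\mathbb{C}$ put $\Omega^*:=\{\overline{z}: z\in\Omega\}$. The essential $\varepsilon$-near spectrum $\Lambda_{\mathrm{ess},\varepsilon}(T)$ is the set of all $\lambda\in\mathbb{C}$ for which there exist $x_n\in\mathrm{dom}(T)$, $n\in\mathbb{N}$, with $\|x_n\|=1$, $x_n\to 0$ weakly, and $\|(T-\lambda)x_n\|\to\varepsilon$. For operators $T_n$ in closed subspaces $H_n\subset H_0$, $n\in\mathbb{N}$, the limiting essential $\varepsilon$-near spectrum $\Lambda_{\mathrm{ess},\varepsilon}((T_n)_{n\in\mathbb{N}})$ is the set of all $\lambda\in\mathbb{C}$ for which there exist an infinite set $I\subset\mathbb{N}$ and $x_n\in\mathrm{dom}(T_n)$, $n\in I$, with $\|x_n\|=1$, $x_n\to0$ weakly in $H_0$, and $\|(T_n-\lambda)x_n\|\to\varepsilon$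 as $n\in I$, $n\to\infty$. Assume that there is a nonempty open set $U\subset\mathbb{C}$ with $U\subset\rho(T)$ and $\|(T-\lambda)^{-1}\|=1/\varepsilon$ for all $\lambda\in U$. (i) Then $$\rho(T)\subset\mathbb{C}\setminus\bigcap_{K}\sigma(T+K)\subset\Lambda_{\mathrm{ess},\varepsilon}(T)\cap\Lambda_{\mathrm{ess},\varepsilon}(T^*)^*,$$ where the intersection is over all compact linear operators $K:H\to H$. (ii) Let $H_n\subset H_0$, $n\in\mathbb{N}$, be closed subspaces with orthogonal projections $P_n:H_0\to H_n$ such that $P_nx\to Px$ for all $x\in H_0$, and let $T_n$ be closed, densely defined linear operators in $H_n$. Suppose that $T_n\to T$ and $T_n^*\to T^*$ in generalised strong resolvent sense, where $T_n\to T$ in this sense means that there are $n_0\in\mathbb{N}$ and $\lambda_0\in\rho(T)\cap\bigcap_{n\ge n_0}\rho(T_n)$ with $(T_n-\lambda_0)^{-1}P_nx\to(T-\lambda_0)^{-1}Px$ for all $x\in H_0$. Then $$\rho(T)\subset\mathbb{C}\setminus\bigcap_{K}\sigma(T+K)\subset\Lambda_{\mathrm{ess},\varepsilon}((T_n)_{n\in\mathbb{N}})\cap\Lambda_{\mathrm{ess},\varepsilon}((T_n^*)_{n\in\mathbb{N}})^*,$$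 with the intersection over $K$ as in (i). -/

import Mathlib

open Filter Topology

namespace UnboundedOperator

noncomputable section

section Single

variable {E : Type*} [NormedAddCommGroup E] [InnerProductSpace ℂ E]

/-- `R` is the bounded, everywhere defined two-sided inverse of `T - z : dom T → E`. -/
structure IsResolventAt (T : E →ₗ.[ℂ] E) (z : ℂ) (R : E →L[ℂ] E) : Prop where
  right_inv : ∀ y : E, ∃ h : R y ∈ T.domain, T ⟨R y, h⟩ - z • R y = y
  left_inv : ∀ x : T.domain, R (T x - z • (x : E)) = x

theorem IsResolventAt.unique {T : E →ₗ.[ℂ] E} {z : ℂ} {R S : E →L[ℂ] E}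
    (hR : IsResolventAt T z R) (hS : IsResolventAt T z S) : R = S := by
  ext y
  obtain ⟨h, hy⟩ := hS.right_inv y
  have := hR.left_inv ⟨S y, h⟩
  rwa [hy] at this

/-- The resolvent set `ρ(T)`. -/
def resolventSet (T : E →ₗ.[ℂ] E) : Set ℂ := {z | ∃ R : E →L[ℂ] E, IsResolventAt T z R}

/-- The spectrum `σ(T) = ℂ \ ρ(T)`. -/
def spectrum (T : E →ₗ.[ℂ] E) : Set ℂ := (resolventSet T)ᶜ

open scoped Classical in
/-- The resolvent `(T - z)⁻¹` for `z ∈ ρ(T)`; outside `ρ(T)` the value is `0` by convention. -/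
def resolvent (T : E →ₗ.[ℂ] E) (z : ℂ) : E →L[ℂ] E :=
  if h : ∃ R : E →L[ℂ] E, IsResolventAt T z R then h.choose else 0

theorem isResolventAt_resolvent {T : E →ₗ.[ℂ] E} {z : ℂ} (h : z ∈ resolventSet T) :
    IsResolventAt T z (resolvent T z) := by
  have h' : ∃ R : E →L[ℂ] E, IsResolventAt T z R := h
  rw [resolvent, dif_pos h']
  exact h'.choose_spec

/-- `T + K` with `dom (T + K) = dom T`, for a bounded operator `K`. -/
def addBounded (T : E →ₗ.[ℂ] E) (K : E →L[ℂ] E) : E →ₗ.[ℂ] E :=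
  (K : E →ₗ[ℂ] E) +ᵥ T

/-- Weak convergence `x i ⇀ a` along the filter `l` in the space `E`. -/
def WeaklyTendsto {ι : Type*} (x : ι → E) (l : Filter ι) (a : E) : Prop :=
  Tendsto (fun i => toWeakSpace ℂ E (x i)) l (𝓝 (toWeakSpace ℂ E a))

/-- The essential `ε`-near spectrum `Λ_{ess,ε}(T)`. -/
def essNearSpectrum (ε : ℝ) (T : E →ₗ.[ℂ] E) : Set ℂ :=
  {z | ∃ x : ℕ → T.domain,
    (∀ n, ‖(x n : E)‖ = 1) ∧
    WeaklyTendsto (fun n => (x n : E)) atTop 0 ∧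
    Tendsto (fun n => ‖T (x n) - z • (x n : E)‖) atTop (𝓝 ε)}

end Single

/-- The complex conjugate set `Ω^* = {conj z : z ∈ Ω}`. -/
def conjSet (Ω : Set ℂ) : Set ℂ := (starRingEnd ℂ) '' Ω

section Sequence

variable {H₀ : Type*} [NormedAddCommGroup H₀] [InnerProductSpace ℂ H₀]

/-- The limiting essential `ε`-near spectrum `Λ_{ess,ε}((T n)_n)` of operators `T n` acting in
subspaces `Hn n` of `H₀`: the vectors `x n` are given for `n` in an infinite set `I` of indices,
and limits are taken as `n → ∞` in `I`. -/
def limEssNearSpectrum (ε : ℝ) {Hn : ℕ → Submodule ℂ H₀}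
    (T : ∀ n, Hn n →ₗ.[ℂ] Hn n) : Set ℂ :=
  {z | ∃ I : Set ℕ, I.Infinite ∧ ∃ x : ∀ n : I, (T n).domain,
    (∀ n : I, ‖(x n : Hn n)‖ = 1) ∧
    WeaklyTendsto (fun n : I => ((x n : Hn n) : H₀)) atTop 0 ∧
    Tendsto (fun n : I => ‖T n (x n) - z • (x n : Hn n)‖) atTop (𝓝 ε)}

/-- `T n → T` in generalised strong resolvent sense, for operators acting in subspaces `Hn n`
and `H` of `H₀`: for some `n₀` and some `z₀` in `ρ(T)` and in all `ρ(T n)`, `n ≥ n₀`, one has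
`(T n - z₀)⁻¹ P_n x → (T - z₀)⁻¹ P x` in `H₀` for every `x ∈ H₀`. -/
def GSRConverges {H : Submodule ℂ H₀} [H.HasOrthogonalProjection] {Hn : ℕ → Submodule ℂ H₀}
    [∀ n, (Hn n).HasOrthogonalProjection]
    (Tn : ∀ n, Hn n →ₗ.[ℂ] Hn n) (T : H →ₗ.[ℂ] H) : Prop :=
  ∃ (n₀ : ℕ) (z₀ : ℂ), z₀ ∈ resolventSet T ∧ (∀ n ≥ n₀, z₀ ∈ resolventSet (Tn n)) ∧
    ∀ x : H₀, Tendsto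
      (fun n => ((resolvent (Tn n) z₀ ((Hn n).orthogonalProjectionOnto x) : Hn n) : H₀)) atTop
      (𝓝 ((resolvent T z₀ (H.orthogonalProjectionOnto x) : H) : H₀))

end Sequence

end

end UnboundedOperator

/-! Fix `z₀ ∈ U` and put `R = (T - z₀)⁻¹`, so `‖R‖ = 1/ε`. Near `z₀` the Taylor coefficients of `(T
- w)⁻¹x` begin with `R x`, `R² x`, and a Parseval-type inequality on a disc of radius `r` in `U`
gives `‖R x‖² + r²‖R² x‖² ≤ (‖x‖/ε)²` (`norm_sq_resolvent_add_le`). A maximizing sequence `x n` for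
`‖R‖` therefore satisfies `R² (x n) → 0`, and injectivity of `R` turns this into `R (x n) ⇀ 0`.

If `S = (T + K - z)⁻¹` with `K` compact, the resolvent identity shows `S (x n) - R (x n) → 0`. So `S
(x n)` is weakly null with norm tending to `1/ε`, while `(T - z) S (x n) = x n - K S (x n)` has norm
tending to `1`; normalizing gives `ε` (`mem_essNearSpectrum_of_const_norm_resolvent`). The adjoint
half is the same argument for `T*`, `K*` and the reflected set `U*`.

For the limiting sets, strong resolvent convergence approximates each vector of a singular sequence
in graph norm, and a diagonal choice finishes (`essNearSpectrum_subset_limEssNearSpectrum`). -/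

namespace UnboundedOperator

/-! ### Weakly null sequences and compact operators. -/

section Weak

variable {E F : Type*} [NormedAddCommGroup E] [InnerProductSpace ℂ E]
  [NormedAddCommGroup F] [InnerProductSpace ℂ F]

theorem weaklyTendsto_iff_forall_dual {ι : Type*} {x : ι → E} {l : Filter ι} {a : E} :
    WeaklyTendsto x l a ↔ ∀ f : E →L[ℂ] ℂ, Tendsto (fun i => f (x i)) l (𝓝 (f a)) := by
  have hinj : Function.Injective (topDualPairing ℂ E).flip := by
    intro u v h
    refine (SeparatingDual.eq_iff_forall_dual_eq (R := ℂ)).2 fun f => ?_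
    exact DFunLike.congr_fun h f
  exact WeakBilin.tendsto_iff_forall_eval_tendsto _ hinj

theorem weaklyTendsto_zero_iff [CompleteSpace E] {ι : Type*} {x : ι → E} {l : Filter ι} :
    WeaklyTendsto x l 0 ↔ ∀ v : E, Tendsto (fun i => inner ℂ v (x i)) l (𝓝 0) := by
  rw [weaklyTendsto_iff_forall_dual]
  constructor
  · intro h v
    simpa using h (innerSL ℂ v)
  · intro h f
    simpa using h ((InnerProductSpace.toDual ℂ E).symm f)

theorem WeaklyTendsto.clm_zero {ι : Type*} {x : ι → E} {l : Filter ι}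
    (h : WeaklyTendsto x l 0) (A : E →L[ℂ] F) : WeaklyTendsto (fun i => A (x i)) l 0 := by
  rw [weaklyTendsto_iff_forall_dual] at h ⊢
  intro f
  simpa using h (f ∘L A)

theorem WeaklyTendsto.zero_of_sub {ι : Type*} {x y : ι → E} {l : Filter ι}
    (h : WeaklyTendsto x l 0) (hy : Tendsto (fun i => y i - x i) l (𝓝 0)) :
    WeaklyTendsto y l 0 := by
  rw [weaklyTendsto_iff_forall_dual] at h ⊢
  intro f
  simpa using (h f).add ((f.continuous.tendsto 0).comp hy)

theorem WeaklyTendsto.smul_zero {ι : Type*} {x : ι → E} {l : Filter ι} {c : ι → ℂ} {d : ℂ}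
    (h : WeaklyTendsto x l 0) (hc : Tendsto c l (𝓝 d)) :
    WeaklyTendsto (fun i => c i • x i) l 0 := by
  rw [weaklyTendsto_iff_forall_dual] at h ⊢
  intro f
  simpa using hc.mul (h f)

theorem WeaklyTendsto.comp_tendsto {ι κ : Type*} {x : ι → E} {l : Filter ι} {a : E}
    (h : WeaklyTendsto x l a) {l' : Filter κ} {φ : κ → ι} (hφ : Tendsto φ l' l) :
    WeaklyTendsto (fun k => x (φ k)) l' a :=
  Tendsto.comp (f := φ) (g := fun i => toWeakSpace ℂ E (x i)) h hφ

/-- `K` maps bounded weakly null sequences to norm null sequences. -/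
def MapsWeaklyNullToNull (K : E →L[ℂ] F) : Prop :=
  ∀ (x : ℕ → E) (C : ℝ), (∀ n, ‖x n‖ ≤ C) → WeaklyTendsto x atTop 0 →
    Tendsto (fun n => K (x n)) atTop (𝓝 0)

theorem mapsWeaklyNullToNull_of_isCompactOperator {K : E →L[ℂ] F} (hK : IsCompactOperator K) :
    MapsWeaklyNullToNull K := by
  intro x C hC hx
  obtain ⟨S, hS, hsub⟩ := hK.image_closedBall_subset_compact (f := (K : E →ₗ[ℂ] F)) C
  have hmem : ∀ n, K (x n) ∈ S := fun n =>
    hsub ⟨x n, by simpa using hC n, rfl⟩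
  refine tendsto_of_subseq_tendsto fun φ hφ => ?_
  obtain ⟨w, -, ψ, hψ, hlim⟩ := hS.tendsto_subseq fun n => hmem (φ n)
  have hw : w = 0 := by
    refine (SeparatingDual.eq_iff_forall_dual_eq (R := ℂ)).2 fun f => ?_
    have h1 := (f.continuous.tendsto w).comp hlim
    have h2 := weaklyTendsto_iff_forall_dual.1
      ((hx.clm_zero K).comp_tendsto (hφ.comp hψ.tendsto_atTop)) f
    exact tendsto_nhds_unique h1 h2
  exact ⟨ψ, hw ▸ hlim⟩

/-- From `‖K* x‖² = ⟪x, K K* x⟫`, with `K* (x n)` again bounded and weakly null. This stands in for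
Schauder's theorem on adjoints of compact operators. -/
theorem MapsWeaklyNullToNull.adjoint [CompleteSpace E] [CompleteSpace F] {K : E →L[ℂ] F}
    (hK : MapsWeaklyNullToNull K) : MapsWeaklyNullToNull K.adjoint := by
  intro x C hC hx
  have h1 : Tendsto (fun n => K (K.adjoint (x n))) atTop (𝓝 0) :=
    hK _ (‖K.adjoint‖ * C) (fun n => (K.adjoint.le_opNorm _).trans (by gcongr; exact hC n))
      (hx.clm_zero K.adjoint)
  have h2 : Tendsto (fun n => ‖K.adjoint (x n)‖ ^ 2) atTop (𝓝 0) := by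
    refine squeeze_zero
      (g := fun n => C * ‖K (K.adjoint (x n))‖) (fun n => by positivity) (fun n => ?_) ?_
    · have : ‖K.adjoint (x n)‖ ^ 2 = ‖inner ℂ (x n) (K (K.adjoint (x n)))‖ := by
        rw [← ContinuousLinearMap.adjoint_inner_left, inner_self_eq_norm_sq_to_K]
        simp
      rw [this]
      refine (norm_inner_le_norm _ _).trans ?_
      gcongr
      exact hC n
    · simpa using h1.norm.const_mul C
  rw [tendsto_zero_iff_norm_tendsto_zero]
  have h3 := h2.sqrt
  simpa [Real.sqrt_sq] using h3

end Weak

/-! ### Resolvent identity, adjoints and injectivity. -/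

section Resolvent

variable {E : Type*} [NormedAddCommGroup E] [InnerProductSpace ℂ E]

theorem resolvent_eq {T : E →ₗ.[ℂ] E} {z : ℂ} {R : E →L[ℂ] E} (h : IsResolventAt T z R) :
    resolvent T z = R :=
  (isResolventAt_resolvent ⟨R, h⟩).unique h

theorem IsResolventAt.injective {T : E →ₗ.[ℂ] E} {z : ℂ} {R : E →L[ℂ] E}
    (h : IsResolventAt T z R) : Function.Injective R := by
  intro x y hxy
  obtain ⟨hx, ex⟩ := h.right_inv x
  obtain ⟨hy, ey⟩ := h.right_inv y
  have : (⟨R x, hx⟩ : T.domain) = ⟨R y, hy⟩ := Subtype.ext hxy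
  rw [← ex, ← ey, this, hxy]

theorem IsResolventAt.sub_eq {T : E →ₗ.[ℂ] E} {z w : ℂ} {R S : E →L[ℂ] E}
    (hR : IsResolventAt T z R) (hS : IsResolventAt T w S) (x : E) :
    R x - S x = (z - w) • R (S x) := by
  obtain ⟨h, e⟩ := hS.right_inv x
  have h1 := hR.left_inv ⟨S x, h⟩
  have h2 : T ⟨S x, h⟩ = x + w • S x := eq_add_of_sub_eq e
  simp only [h2, map_sub, map_add, map_smul] at h1
  rw [← sub_eq_zero] at h1 ⊢
  rw [← h1]
  module

theorem isResolventAt_addBounded_iff {T : E →ₗ.[ℂ] E} {K : E →L[ℂ] E} {z : ℂ} {R : E →L[ℂ] E} :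
    IsResolventAt (addBounded T K) z R ↔
      (∀ y, ∃ h : R y ∈ T.domain, K (R y) + T ⟨R y, h⟩ - z • R y = y) ∧
      ∀ x : T.domain, R (K x + T x - z • (x : E)) = x :=
  ⟨fun h => ⟨h.1, h.2⟩, fun h => ⟨h.1, h.2⟩⟩

theorem addBounded_zero (T : E →ₗ.[ℂ] E) : addBounded T 0 = T :=
  zero_vadd (E →ₗ[ℂ] E) T

theorem isResolventAt_adjoint_addBounded [CompleteSpace E] {T : E →ₗ.[ℂ] E}
    (hT : Dense (T.domain : Set E)) {K : E →L[ℂ] E} {z : ℂ} {R : E →L[ℂ] E}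
    (h : IsResolventAt (addBounded T K) z R) :
    IsResolventAt (addBounded T.adjoint K.adjoint) (starRingEnd ℂ z) R.adjoint := by
  rw [isResolventAt_addBounded_iff] at h ⊢
  constructor
  · intro y
    have key : ∀ x : T.domain,
        inner ℂ (y - K.adjoint (R.adjoint y) + starRingEnd ℂ z • R.adjoint y) (x : E) =
          inner ℂ (R.adjoint y) (T x) := by
      intro x
      have h1 := h.2 x
      have h2 : inner ℂ y (R (K x + T x - z • (x : E))) = inner ℂ y (x : E) := by rw [h1]
      rw [← ContinuousLinearMap.adjoint_inner_left] at h2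
      simp only [inner_add_left, inner_sub_left, inner_sub_right, inner_add_right,
        inner_smul_left, inner_smul_right, ContinuousLinearMap.adjoint_inner_left,
        RingHomCompTriple.comp_apply, RingHom.id_apply] at h2 ⊢
      rw [← h2]; ring
    have hmem : R.adjoint y ∈ T.adjoint.domain :=
      LinearPMap.mem_adjoint_domain_of_exists _ ⟨_, key⟩
    refine ⟨hmem, ?_⟩
    have e := LinearPMap.adjoint_apply_eq hT ⟨_, hmem⟩ key
    rw [e]
    module
  · intro x
    refine ext_inner_right ℂ fun v => ?_
    obtain ⟨hm, e⟩ := h.1 v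
    have h1 := LinearPMap.adjoint_isFormalAdjoint hT x ⟨R v, hm⟩
    rw [ContinuousLinearMap.adjoint_inner_left]
    conv_rhs => rw [← e]
    simp only [inner_add_left, inner_sub_left, inner_sub_right, inner_add_right,
        inner_smul_left, inner_smul_right, ContinuousLinearMap.adjoint_inner_left,
        Complex.conj_conj, h1]

theorem IsResolventAt.adjoint [CompleteSpace E] {T : E →ₗ.[ℂ] E}
    (hT : Dense (T.domain : Set E)) {z : ℂ} {R : E →L[ℂ] E} (h : IsResolventAt T z R) :
    IsResolventAt T.adjoint (starRingEnd ℂ z) R.adjoint := by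
  rw [← addBounded_zero T] at h
  have := isResolventAt_adjoint_addBounded (by exact hT) h
  rwa [map_zero, addBounded_zero] at this

/-- A null sequence of images under an injective operator makes a bounded sequence weakly null. -/
theorem weaklyTendsto_zero_of_injective [CompleteSpace E] {R : E →L[ℂ] E}
    (hR : Function.Injective R) {u : ℕ → E} {C : ℝ} (hC : ∀ n, ‖u n‖ ≤ C)
    (hu : Tendsto (fun n => R (u n)) atTop (𝓝 0)) : WeaklyTendsto u atTop 0 := by
  rw [weaklyTendsto_zero_iff]
  have hC0 : 0 ≤ C := (norm_nonneg _).trans (hC 0)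
  -- The orthogonal complement of `ran R*` is `ker R = 0`. Since `u` is bounded, it suffices to test
  -- against this dense range.
  have hdense : DenseRange R.adjoint := by
    have h1 : (R.adjoint.range)ᗮ = ⊥ := by
      rw [ContinuousLinearMap.orthogonal_range, ContinuousLinearMap.adjoint_adjoint]
      exact LinearMap.ker_eq_bot.2 hR
    have h2 := Submodule.topologicalClosure_eq_top_iff.2 h1
    have h3 := Submodule.dense_iff_topologicalClosure_eq_top.2 h2
    exact h3
  intro v
  rw [Metric.tendsto_atTop]
  intro δ hδ
  obtain ⟨w, hw⟩ := hdense.exists_dist_lt v (ε := δ / (2 * (C + 1))) (by positivity)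
  have h1 : Tendsto (fun n => inner ℂ w (R (u n))) atTop (𝓝 0) := by
    simpa using (tendsto_const_nhds (x := w)).inner (𝕜 := ℂ) hu
  obtain ⟨N, hN⟩ := (Metric.tendsto_atTop.1 h1) (δ / 2) (by positivity)
  refine ⟨N, fun n hn => ?_⟩
  have h2 := hN n hn
  rw [dist_zero_right] at h2 ⊢
  rw [dist_eq_norm] at hw
  have h3 : inner ℂ v (u n) = inner ℂ (v - R.adjoint w) (u n) + inner ℂ w (R (u n)) := by
    rw [inner_sub_left, ContinuousLinearMap.adjoint_inner_left]; ring
  rw [h3]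
  have h4 : ‖inner ℂ (v - R.adjoint w) (u n)‖ ≤ δ / 2 := by
    calc _ ≤ ‖v - R.adjoint w‖ * ‖u n‖ := norm_inner_le_norm _ _
      _ ≤ δ / (2 * (C + 1)) * (C + 1) := by
        gcongr
        linarith [hC n]
      _ = δ / 2 := by field_simp
  linarith [norm_add_le (inner ℂ (v - R.adjoint w) (u n)) (inner ℂ w (R (u n)))]

end Resolvent

/-! ### The mean value inequality for the resolvent. -/

section Energy

variable {E : Type*} [NormedAddCommGroup E] [InnerProductSpace ℂ E]

theorem resolvent_sub_eq {T : E →ₗ.[ℂ] E} {z w : ℂ} (hz : z ∈ resolventSet T)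
    (hw : w ∈ resolventSet T) (x : E) :
    resolvent T z x - resolvent T w x = (z - w) • resolvent T z (resolvent T w x) :=
  (isResolventAt_resolvent hz).sub_eq (isResolventAt_resolvent hw) x

theorem hasDerivAt_inner_resolvent {T : E →ₗ.[ℂ] E} {U : Set ℂ} (hU : IsOpen U)
    (hsub : U ⊆ resolventSet T) {M : ℝ} (hM : ∀ z ∈ U, ‖resolvent T z‖ ≤ M) {z : ℂ} (hz : z ∈ U)
    (a b : E) :
    HasDerivAt (fun w => inner ℂ a (resolvent T w b))
      (inner ℂ a (resolvent T z (resolvent T z b))) z := by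
  have hcont : ∀ c : E, Tendsto (fun w => resolvent T w c) (𝓝 z) (𝓝 (resolvent T z c)) := by
    intro c
    rw [tendsto_iff_norm_sub_tendsto_zero]
    have h0 : Tendsto (fun w : ℂ => ‖w - z‖ * (M * ‖resolvent T z c‖)) (𝓝 z) (𝓝 0) := by
      have : Tendsto (fun w : ℂ => ‖w - z‖ * (M * ‖resolvent T z c‖)) (𝓝 z)
          (𝓝 (‖z - z‖ * (M * ‖resolvent T z c‖))) := Continuous.tendsto (by fun_prop) z
      simpa using this
    refine squeeze_zero' (.of_forall fun _ => norm_nonneg _) ?_ h0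
    filter_upwards [hU.mem_nhds hz] with w hw
    rw [resolvent_sub_eq (hsub hw) (hsub hz), norm_smul]
    gcongr
    exact (resolvent T w).le_of_opNorm_le (hM w hw) _
  rw [hasDerivAt_iff_tendsto_slope]
  have h1 : Tendsto (fun w => inner ℂ a (resolvent T w (resolvent T z b))) (𝓝[≠] z)
      (𝓝 (inner ℂ a (resolvent T z (resolvent T z b)))) :=
    (tendsto_const_nhds.inner (hcont _)).mono_left nhdsWithin_le_nhds
  refine h1.congr' ?_
  filter_upwards [self_mem_nhdsWithin, mem_nhdsWithin_of_mem_nhds (hU.mem_nhds hz)] with w hne hw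
  have hne' : w - z ≠ 0 := sub_ne_zero.2 hne
  rw [slope_def_field, ← inner_sub_right, resolvent_sub_eq (hsub hw) (hsub hz), inner_smul_right]
  field_simp

/-- A mean value inequality: if the resolvent is bounded by `M` near the closed disc of radius `r`
about `z`, its first two Taylor coefficients there are controlled by `M`. -/
theorem norm_sq_resolvent_add_le {T : E →ₗ.[ℂ] E} {U : Set ℂ} (hU : IsOpen U)
    (hsub : U ⊆ resolventSet T) {M : ℝ} (hM : ∀ z ∈ U, ‖resolvent T z‖ ≤ M) {z : ℂ} {r : ℝ}
    (hr : 0 < r) (hball : Metric.closedBall z r ⊆ U) (x : E) :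
    ‖resolvent T z x‖ ^ 2 + r ^ 2 * ‖resolvent T z (resolvent T z x)‖ ^ 2 ≤ (M * ‖x‖) ^ 2 := by
  have hz : z ∈ U := hball (Metric.mem_closedBall_self hr.le)
  set a := resolvent T z x with ha
  set b := resolvent T z a with hb
  set s := ‖a‖ ^ 2 + r ^ 2 * ‖b‖ ^ 2 with hs
  -- `Ψ` is holomorphic and pairs the resolvent with its own first two Taylor coefficients: `Re Ψ =
  -- 2s` at the centre, while `Re Ψ ≤ s + (M‖x‖)²` on the circle.
  let Ψ : ℂ → ℂ := fun w =>
    2 * inner ℂ a (resolvent T w x) + 2 * (r : ℂ) ^ 2 * inner ℂ b (resolvent T w a)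
  have hΨ : DifferentiableOn ℂ Ψ U := by
    intro w hw
    have h1 := (hasDerivAt_inner_resolvent hU hsub hM hw a x).differentiableAt
    have h2 := (hasDerivAt_inner_resolvent hU hsub hM hw b a).differentiableAt
    exact ((h1.const_mul 2).add (h2.const_mul (2 * (r : ℂ) ^ 2))).differentiableWithinAt
  have hcenter : (Ψ z).re = 2 * s := by
    have e : Ψ z = ((2 * s : ℝ) : ℂ) := by
      simp only [Ψ, ← ha, ← hb, inner_self_eq_norm_sq_to_K, hs]
      push_cast
      simp
      ring
    rw [e, Complex.ofReal_re]
  have hsphere : ∀ w ∈ Metric.sphere z r, (Ψ w).re ≤ (M * ‖x‖) ^ 2 + s := by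
    intro w hw
    have hwU : w ∈ U := hball (Metric.sphere_subset_closedBall hw)
    have hnorm : ‖w - z‖ = r := by rwa [← dist_eq_norm]
    set h := w - z
    set y := resolvent T w x
    have hy : h • resolvent T w a = y - a := (resolvent_sub_eq (hsub hwU) (hsub hz) x).symm
    have hr2 : (r : ℂ) ^ 2 = starRingEnd ℂ h * h := by
      rw [← hnorm, Complex.conj_mul']
    have e1 : (r : ℂ) ^ 2 * inner ℂ b (resolvent T w a) = inner ℂ (h • b) (y - a) := by
      rw [← hy, inner_smul_left, inner_smul_right, hr2]; ring
    have e2 : (Ψ w).re = 2 * (inner ℂ (a + h • b) y).re - 2 * (inner ℂ (h • b) a).re := by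
      have e : Ψ w = ((2 : ℝ) : ℂ) * (inner ℂ (a + h • b) y - inner ℂ (h • b) a) := by
        simp only [Ψ, mul_assoc, e1, inner_sub_right, inner_add_left]
        push_cast
        ring
      rw [e, Complex.re_ofReal_mul, Complex.sub_re]
      ring
    have e3 := norm_sub_sq (𝕜 := ℂ) (a + h • b) y
    have e4 := norm_add_sq (𝕜 := ℂ) (h • b) a
    have e5 : ‖h • b‖ ^ 2 = r ^ 2 * ‖b‖ ^ 2 := by rw [norm_smul, hnorm, mul_pow]
    have e6 : ‖y‖ ^ 2 ≤ (M * ‖x‖) ^ 2 := by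
      gcongr
      exact (resolvent T w).le_of_opNorm_le (hM w hwU) x
    rw [add_comm (h • b) a, e5] at e4
    simp only [RCLike.re_to_complex] at e3 e4
    rw [e2]
    -- Expanding `0 ≤ ‖a + h b - y‖²`, the cross term of `a` and `h b` cancels the one in `e2`.
    nlinarith [sq_nonneg ‖a + h • b - y‖]
  -- As `‖exp Ψ‖ = exp (Re Ψ)`, maximum modulus becomes a maximum principle for `Re Ψ`.
  have hmax := Complex.norm_le_of_forall_mem_frontier_norm_le (f := fun w => Complex.exp (Ψ w))
    (U := Metric.ball z r) Metric.isBounded_ball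
    (C := Real.exp ((M * ‖x‖) ^ 2 + s))
    (DifferentiableOn.diffContOnCl (by
      rw [closure_ball z hr.ne']
      exact (hΨ.mono hball).cexp))
    (by
      intro w hw
      rw [frontier_ball z hr.ne'] at hw
      rw [Complex.norm_exp, Real.exp_le_exp]
      exact hsphere w hw)
    (subset_closure (Metric.mem_ball_self hr))
  rw [Complex.norm_exp, Real.exp_le_exp, hcenter] at hmax
  linarith

end Energy

/-! ### Singular sequences from a constant resolvent norm. -/

section NearSpectrum

variable {E : Type*} [NormedAddCommGroup E] [InnerProductSpace ℂ E]

theorem mem_essNearSpectrum_of_tendsto {T : E →ₗ.[ℂ] E} {z : ℂ} {v : ℕ → T.domain} {c d : ℝ}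
    (hc : 0 < c) (hv : Tendsto (fun n => ‖(v n : E)‖) atTop (𝓝 c))
    (hweak : WeaklyTendsto (fun n => (v n : E)) atTop 0)
    (hT : Tendsto (fun n => ‖T (v n) - z • (v n : E)‖) atTop (𝓝 d)) :
    z ∈ essNearSpectrum (d / c) T := by
  obtain ⟨N, hN⟩ := eventually_atTop.1 (hv.eventually (lt_mem_nhds hc))
  have hpos : ∀ n, 0 < ‖(v (n + N) : E)‖ := fun n => hN _ (Nat.le_add_left N n)
  have hshift := tendsto_add_atTop_nat N
  have hinv : Tendsto (fun n => ‖(v (n + N) : E)‖⁻¹) atTop (𝓝 c⁻¹) :=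
    (hv.comp hshift).inv₀ hc.ne'
  refine ⟨fun n => ((‖(v (n + N) : E)‖⁻¹ : ℝ) : ℂ) • v (n + N), fun n => ?_, ?_, ?_⟩
  · simp [norm_smul, (hpos n).ne']
  · exact (hweak.comp_tendsto hshift).smul_zero
      ((Complex.continuous_ofReal.tendsto _).comp hinv)
  · have h1 := hinv.mul (hT.comp hshift)
    rw [div_eq_inv_mul]
    refine h1.congr fun n => ?_
    have : T (((‖(v (n + N) : E)‖⁻¹ : ℝ) : ℂ) • v (n + N)) -
        z • ((((‖(v (n + N) : E)‖⁻¹ : ℝ) : ℂ) • v (n + N) : T.domain) : E) =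
        ((‖(v (n + N) : E)‖⁻¹ : ℝ) : ℂ) • (T (v (n + N)) - z • (v (n + N) : E)) := by
      rw [LinearPMap.map_smul, Submodule.coe_smul]
      module
    simp only [Function.comp_apply]
    rw [this, norm_smul]
    simp

theorem exists_maximizing_seq {A : E →L[ℂ] E} (hA : 0 < ‖A‖) :
    ∃ x : ℕ → E, (∀ n, ‖x n‖ ≤ 1) ∧ Tendsto (fun n => ‖x n‖) atTop (𝓝 1) ∧
      Tendsto (fun n => ‖A (x n)‖) atTop (𝓝 ‖A‖) := by
  have h : ∀ n : ℕ, ∃ x : E, ‖x‖ < 1 ∧ ‖A‖ - 1 / ((n : ℝ) + 1) < ‖A x‖ := fun n => by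
    simpa using A.exists_lt_apply_of_lt_opNorm (r := ‖A‖ - 1 / ((n : ℝ) + 1))
      (sub_lt_self _ (by positivity))
  choose x hx1 hxA using h
  have hle : ∀ n, ‖A (x n)‖ ≤ ‖A‖ * ‖x n‖ := fun n => A.le_opNorm _
  have hlim : Tendsto (fun n : ℕ => ‖A‖ - 1 / ((n : ℝ) + 1)) atTop (𝓝 ‖A‖) := by
    simpa using tendsto_one_div_add_atTop_nhds_zero_nat.const_sub ‖A‖
  have hAx : Tendsto (fun n => ‖A (x n)‖) atTop (𝓝 ‖A‖) :=
    tendsto_of_tendsto_of_tendsto_of_le_of_le hlim tendsto_const_nhds (fun n => (hxA n).le)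
      fun n => (hle n).trans (mul_le_of_le_one_right hA.le (hx1 n).le)
  refine ⟨x, fun n => (hx1 n).le, ?_, hAx⟩
  have h1 : Tendsto (fun n => ‖A (x n)‖ / ‖A‖) atTop (𝓝 1) := by
    simpa [hA.ne'] using hAx.div_const ‖A‖
  refine tendsto_of_tendsto_of_tendsto_of_le_of_le h1 tendsto_const_nhds (fun n => ?_)
    fun n => (hx1 n).le
  rw [div_le_iff₀ hA, mul_comm]
  exact hle n

theorem mem_essNearSpectrum_of_const_norm_resolvent [CompleteSpace E] {T : E →ₗ.[ℂ] E} {ε : ℝ}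
    (hε : 0 < ε) {U : Set ℂ} (hU : IsOpen U) (hne : U.Nonempty) (hsub : U ⊆ resolventSet T)
    (hnorm : ∀ w ∈ U, ‖resolvent T w‖ = 1 / ε) {K : E →L[ℂ] E} (hK : MapsWeaklyNullToNull K)
    {z : ℂ} {S : E →L[ℂ] E} (hS : IsResolventAt (addBounded T K) z S) :
    z ∈ essNearSpectrum ε T := by
  obtain ⟨z₀, hz₀⟩ := hne
  obtain ⟨r, hr, hball⟩ := Metric.nhds_basis_closedBall.mem_iff.1 (hU.mem_nhds hz₀)
  set R := resolvent T z₀ with hRdef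
  have hR : IsResolventAt T z₀ R := isResolventAt_resolvent (hsub hz₀)
  have hRnorm : ‖R‖ = 1 / ε := hnorm z₀ hz₀
  obtain ⟨x, hx1, hx, hRx⟩ := exists_maximizing_seq (A := R) (by rw [hRnorm]; positivity)
  have hRR : Tendsto (fun n => R (R (x n))) atTop (𝓝 0) := by
    have hbound : ∀ n, ‖R (R (x n))‖ ^ 2 ≤ (‖R‖ ^ 2 - ‖R (x n)‖ ^ 2) / r ^ 2 := by
      intro n
      have h1 := norm_sq_resolvent_add_le hU hsub (fun w hw => (hnorm w hw).le) hr hball (x n)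
      rw [← hRnorm] at h1
      have h2 : (‖R‖ * ‖x n‖) ^ 2 ≤ ‖R‖ ^ 2 := by
        gcongr
        exact mul_le_of_le_one_right (norm_nonneg _) (hx1 n)
      rw [le_div_iff₀ (by positivity)]
      linarith
    have h3 : Tendsto (fun n => ‖R (R (x n))‖ ^ 2) atTop (𝓝 0) := by
      refine squeeze_zero (fun n => by positivity) hbound ?_
      have h4 := ((hRx.pow 2).const_sub (‖R‖ ^ 2)).div_const (r ^ 2)
      rwa [sub_self, zero_div] at h4
    rw [tendsto_zero_iff_norm_tendsto_zero]
    simpa [Real.sqrt_sq] using h3.sqrt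
  have hRbdd : ∀ n, ‖R (x n)‖ ≤ ‖R‖ := fun n =>
    (R.le_opNorm _).trans (mul_le_of_le_one_right (norm_nonneg _) (hx1 n))
  have hweak : WeaklyTendsto (fun n => R (x n)) atTop 0 :=
    weaklyTendsto_zero_of_injective hR.injective hRbdd hRR
  have hKR : Tendsto (fun n => K (R (x n))) atTop (𝓝 0) := hK _ _ hRbdd hweak
  rw [isResolventAt_addBounded_iff] at hS
  obtain ⟨hS1, hS2⟩ := hS
  -- Apply the left inverse `S` to `(T + K - z) R y = y + K R y + (z₀ - z) R y`.
  have hSR : ∀ y, S y = R y - S (K (R y)) - (z₀ - z) • S (R y) := by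
    intro y
    obtain ⟨h, e⟩ := hR.right_inv y
    have h1 := hS2 ⟨R y, h⟩
    simp only [eq_add_of_sub_eq e, map_add, map_sub, map_smul] at h1
    rw [← sub_eq_zero] at h1 ⊢
    rw [← h1]
    module
  have hnull : ∀ {y : ℕ → E}, Tendsto y atTop (𝓝 0) → ∀ A : E →L[ℂ] E,
      Tendsto (fun n => A (y n)) atTop (𝓝 0) := fun hy A => by
    simpa [Function.comp_def] using (A.continuous.tendsto 0).comp hy
  have hSRx : Tendsto (fun n => S (R (x n))) atTop (𝓝 0) := by
    have h1 := (hRR.sub (hnull (hnull hRR K) S)).sub ((hnull hRR S).const_smul (z₀ - z))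
    simp only [sub_zero, smul_zero] at h1
    exact h1.congr fun n => (hSR _).symm
  have hdiff : Tendsto (fun n => S (x n) - R (x n)) atTop (𝓝 0) := by
    have h1 := (hnull hKR S).neg.sub (hSRx.const_smul (z₀ - z))
    simp only [neg_zero, sub_zero, smul_zero] at h1
    refine h1.congr fun n => ?_
    rw [hSR (x n)]
    module
  have hweakS : WeaklyTendsto (fun n => S (x n)) atTop 0 := hweak.zero_of_sub hdiff
  have hnormS : Tendsto (fun n => ‖S (x n)‖) atTop (𝓝 ‖R‖) := by
    have h1 : Tendsto (fun n => ‖S (x n)‖ - ‖R (x n)‖) atTop (𝓝 0) :=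
      squeeze_zero_norm (fun n => abs_norm_sub_norm_le _ _) (by simpa using hdiff.norm)
    simpa using h1.add hRx
  have hKS : Tendsto (fun n => K (S (x n))) atTop (𝓝 0) :=
    hK _ ‖S‖ (fun n => (S.le_opNorm _).trans
      (mul_le_of_le_one_right (norm_nonneg _) (hx1 n))) hweakS
  choose hmem heq using fun n => hS1 (x n)
  have hTS : Tendsto (fun n => ‖T ⟨S (x n), hmem n⟩ - z • S (x n)‖) atTop (𝓝 1) := by
    have h1 : Tendsto (fun n => ‖T ⟨S (x n), hmem n⟩ - z • S (x n)‖ - ‖x n‖) atTop (𝓝 0) := by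
      refine squeeze_zero_norm (fun n => abs_norm_sub_norm_le _ _) ?_
      have h2 := hKS.norm
      rw [norm_zero] at h2
      refine h2.congr fun n => ?_
      have e : T ⟨S (x n), hmem n⟩ - z • S (x n) - x n = -K (S (x n)) := by
        rw [sub_eq_iff_eq_add, ← sub_eq_iff_eq_add']
        refine Eq.trans ?_ (heq n)
        abel
      rw [e, norm_neg]
    simpa using h1.add hx
  have := mem_essNearSpectrum_of_tendsto (v := fun n => ⟨S (x n), hmem n⟩)
    (by rw [hRnorm]; positivity) hnormS hweakS hTS
  rwa [hRnorm, one_div_one_div] at this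

end NearSpectrum

/-! ### Transfer to approximating operators. -/

section Limiting

variable {H₀ : Type*} [NormedAddCommGroup H₀] [InnerProductSpace ℂ H₀]

/-- With `g = (T - z₀) y`, the vectors `u n = (Tn n - z₀)⁻¹ P_n g` work, since `Tn n (u n) = P_n g +
z₀ u n`. The indices below `n₀` get the harmless value `0`. -/
theorem GSRConverges.exists_approx {H : Submodule ℂ H₀} [H.HasOrthogonalProjection]
    {Hn : ℕ → Submodule ℂ H₀} [∀ n, (Hn n).HasOrthogonalProjection]
    {Tn : ∀ n, Hn n →ₗ.[ℂ] Hn n} {T : H →ₗ.[ℂ] H} (h : GSRConverges Tn T)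
    (hP : ∀ x : H₀, Tendsto (fun n => (Hn n).starProjection x) atTop (𝓝 (H.starProjection x)))
    (y : T.domain) :
    ∃ u : ∀ n, (Tn n).domain,
      Tendsto (fun n => ((u n : Hn n) : H₀)) atTop (𝓝 ((y : H) : H₀)) ∧
      Tendsto (fun n => ((Tn n (u n) : Hn n) : H₀)) atTop (𝓝 ((T y : H) : H₀)) := by
  obtain ⟨n₀, z₀, hz, hzn, hconv⟩ := h
  set g : H := T y - z₀ • (y : H) with hg
  have hRg : resolvent T z₀ g = y := (isResolventAt_resolvent hz).left_inv y
  have hPg : ∀ n ≥ n₀, ∃ u : (Tn n).domain,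
      (u : Hn n) = resolvent (Tn n) z₀ ((Hn n).orthogonalProjectionOnto (g : H₀)) ∧
      Tn n u = (Hn n).orthogonalProjectionOnto (g : H₀) + z₀ • (u : Hn n) := by
    intro n hn
    obtain ⟨hm, e⟩ := (isResolventAt_resolvent (hzn n hn)).right_inv
      ((Hn n).orthogonalProjectionOnto (g : H₀))
    exact ⟨⟨_, hm⟩, rfl, eq_add_of_sub_eq e⟩
  have hall : ∀ n, ∃ u : (Tn n).domain, n₀ ≤ n →
      (u : Hn n) = resolvent (Tn n) z₀ ((Hn n).orthogonalProjectionOnto (g : H₀)) ∧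
      Tn n u = (Hn n).orthogonalProjectionOnto (g : H₀) + z₀ • (u : Hn n) := fun n => by
    by_cases hn : n₀ ≤ n
    · obtain ⟨u, hu⟩ := hPg n hn
      exact ⟨u, fun _ => hu⟩
    · exact ⟨0, fun h => absurd h hn⟩
  choose u hu using hall
  have hulim : Tendsto (fun n => ((u n : Hn n) : H₀)) atTop (𝓝 ((y : H) : H₀)) := by
    have h1 := hconv (g : H₀)
    rw [Submodule.orthogonalProjectionOnto_mem_subspace_eq_self, hRg] at h1
    refine h1.congr' ?_
    filter_upwards [eventually_ge_atTop n₀] with n hn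
    rw [(hu n hn).1]
  refine ⟨u, hulim, ?_⟩
  have h2 := (hP (g : H₀)).add (hulim.const_smul z₀)
  have e : H.starProjection (g : H₀) + z₀ • ((y : H) : H₀) = ((T y : H) : H₀) := by
    rw [Submodule.starProjection_eq_self_iff.2 g.2, hg]
    push_cast
    module
  rw [e] at h2
  refine h2.congr' ?_
  filter_upwards [eventually_ge_atTop n₀] with n hn
  rw [(hu n hn).2]
  rfl

theorem essNearSpectrum_subset_limEssNearSpectrum {H : Submodule ℂ H₀}
    [H.HasOrthogonalProjection] {Hn : ℕ → Submodule ℂ H₀}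
    [∀ n, (Hn n).HasOrthogonalProjection] {Tn : ∀ n, Hn n →ₗ.[ℂ] Hn n} {T : H →ₗ.[ℂ] H}
    (h : GSRConverges Tn T)
    (hP : ∀ x : H₀, Tendsto (fun n => (Hn n).starProjection x) atTop (𝓝 (H.starProjection x)))
    (ε : ℝ) : essNearSpectrum ε T ⊆ limEssNearSpectrum ε Tn := by
  rintro z ⟨x, hx1, hxw, hxT⟩
  have approx : ∀ k : ℕ, ∃ N, ∀ n ≥ N, ∃ u : (Tn n).domain, ‖(u : Hn n)‖ = 1 ∧
      ‖((u : Hn n) : H₀) - ((x k : H) : H₀)‖ < 1 / ((k : ℝ) + 1) ∧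
      |‖Tn n u - z • (u : Hn n)‖ - ‖T (x k) - z • (x k : H)‖| < 1 / ((k : ℝ) + 1) := by
    intro k
    obtain ⟨u, hu, hTu⟩ := h.exists_approx hP (x k)
    have hk : (0 : ℝ) < 1 / ((k : ℝ) + 1) := by positivity
    have hun : Tendsto (fun n => ‖(u n : Hn n)‖) atTop (𝓝 1) := by
      have := hu.norm
      rwa [← Submodule.coe_norm, hx1 k] at this
    have hinv : Tendsto (fun n => ‖(u n : Hn n)‖⁻¹) atTop (𝓝 1) := by
      simpa using hun.inv₀ one_ne_zero
    have hinvC : Tendsto (fun n => ((‖(u n : Hn n)‖⁻¹ : ℝ) : ℂ)) atTop (𝓝 1) := by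
      simpa [Function.comp_def] using (Complex.continuous_ofReal.tendsto _).comp hinv
    have l1 : Tendsto (fun n => ‖((‖(u n : Hn n)‖⁻¹ : ℝ) : ℂ) • ((u n : Hn n) : H₀) -
        ((x k : H) : H₀)‖) atTop (𝓝 0) := by
      simpa using ((hinvC.smul hu).sub_const ((x k : H) : H₀)).norm
    have l2 : Tendsto (fun n => |‖((‖(u n : Hn n)‖⁻¹ : ℝ) : ℂ) •
        (((Tn n (u n) : Hn n) : H₀) - z • ((u n : Hn n) : H₀))‖ - ‖T (x k) - z • (x k : H)‖|)
        atTop (𝓝 0) := by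
      have := ((hinvC.smul (hTu.sub (hu.const_smul z))).norm.sub_const
        ‖T (x k) - z • (x k : H)‖).abs
      have e : ‖(1 : ℂ) • (((T (x k) : H) : H₀) - z • ((x k : H) : H₀))‖ =
          ‖T (x k) - z • (x k : H)‖ := by rw [one_smul]; rfl
      rwa [e, sub_self, abs_zero] at this
    obtain ⟨N, hN⟩ := eventually_atTop.1 ((hun.eventually (lt_mem_nhds one_pos)).and
      ((l1.eventually (gt_mem_nhds hk)).and (l2.eventually (gt_mem_nhds hk))))
    refine ⟨N, fun n hn => ?_⟩
    obtain ⟨p0, p1, p2⟩ := hN n hn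
    refine ⟨((‖(u n : Hn n)‖⁻¹ : ℝ) : ℂ) • u n, ?_, ?_, ?_⟩
    · rw [Submodule.coe_smul, norm_smul]
      simp [p0.ne', -Submodule.coe_norm]
    · simpa only [Submodule.coe_smul] using p1
    · have e : Tn n (((‖(u n : Hn n)‖⁻¹ : ℝ) : ℂ) • u n) -
          z • ((((‖(u n : Hn n)‖⁻¹ : ℝ) : ℂ) • u n : (Tn n).domain) : Hn n) =
          ((‖(u n : Hn n)‖⁻¹ : ℝ) : ℂ) • (Tn n (u n) - z • (u n : Hn n)) := by
        rw [LinearPMap.map_smul, Submodule.coe_smul]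
        module
      rw [e]
      exact p2
  choose N hN using approx
  obtain ⟨φ, hφ, hφN⟩ : ∃ φ : ℕ → ℕ, StrictMono φ ∧ ∀ k, N k ≤ φ k := by
    -- The added `1` makes the partial sums strictly increasing even where `N` vanishes.
    refine ⟨fun k => ∑ j ∈ Finset.range (k + 1), (N j + 1), ?_, fun k => ?_⟩
    · refine strictMono_nat_of_lt_succ fun k => ?_
      rw [Finset.sum_range_succ _ (k + 1)]
      omega
    · change N k ≤ ∑ j ∈ Finset.range (k + 1), (N j + 1)
      rw [Finset.sum_range_succ]
      omega
  -- The infinite index set is the range of `φ`; `κ`, the inverse of `φ`, tells which `x k` is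
  -- approximated at index `n`.
  have hex : ∀ n : Set.range φ, ∃ k, φ k = n := fun n => n.2
  choose κ hκ using hex
  have hw : ∀ n : Set.range φ, N (κ n) ≤ n := fun n => (hφN _).trans (hκ n).le
  choose u hu1 hux huT using fun n : Set.range φ => hN (κ n) n (hw n)
  have hκtop : Tendsto κ atTop atTop := by
    refine tendsto_atTop.2 fun m => ?_
    filter_upwards [eventually_ge_atTop (⟨φ m, m, rfl⟩ : Set.range φ)] with n hn
    rw [← hφ.le_iff_le, hκ n]
    exact hn
  have hsmall : Tendsto (fun n => 1 / ((κ n : ℝ) + 1)) atTop (𝓝 0) :=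
    tendsto_one_div_add_atTop_nhds_zero_nat.comp hκtop
  refine ⟨Set.range φ, Set.infinite_range_of_injective hφ.injective, u, hu1, ?_, ?_⟩
  · have h1 : WeaklyTendsto (fun n => ((x (κ n) : H) : H₀)) atTop 0 :=
      (hxw.clm_zero H.subtypeL).comp_tendsto hκtop
    exact h1.zero_of_sub (squeeze_zero_norm (fun n => (hux n).le) hsmall)
  · have h1 : Tendsto (fun n : Set.range φ => ‖Tn n (u n) - z • (u n : Hn n)‖ -
        ‖T (x (κ n)) - z • (x (κ n) : H)‖) atTop (𝓝 0) :=
      squeeze_zero_norm (fun n => (huT n).le) hsmall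
    simpa using h1.add (hxT.comp hκtop)

end Limiting

/-! ### Assembly, including the adjoint half. -/

theorem mem_compl_iInter_spectrum_iff {E : Type*} [NormedAddCommGroup E] [InnerProductSpace ℂ E]
    {T : E →ₗ.[ℂ] E} {z : ℂ} :
    z ∈ (⋂ (K : E →L[ℂ] E) (_ : IsCompactOperator K), spectrum (addBounded T K))ᶜ ↔
      ∃ K : E →L[ℂ] E, IsCompactOperator K ∧ z ∈ resolventSet (addBounded T K) := by
  simp [spectrum]

theorem compl_iInter_spectrum_subset_essNearSpectrum {E : Type*} [NormedAddCommGroup E]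
    [InnerProductSpace ℂ E] [CompleteSpace E] {T : E →ₗ.[ℂ] E}
    (hT : Dense (T.domain : Set E)) {ε : ℝ} (hε : 0 < ε) {U : Set ℂ} (hU : IsOpen U)
    (hne : U.Nonempty) (hsub : U ⊆ resolventSet T) (hnorm : ∀ w ∈ U, ‖resolvent T w‖ = 1 / ε) :
    (⋂ (K : E →L[ℂ] E) (_ : IsCompactOperator K), spectrum (addBounded T K))ᶜ ⊆
      essNearSpectrum ε T ∩ conjSet (essNearSpectrum ε T.adjoint) := by
  intro z hz
  obtain ⟨K, hK, S, hS⟩ := mem_compl_iInter_spectrum_iff.1 hz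
  have hK' := mapsWeaklyNullToNull_of_isCompactOperator hK
  refine ⟨mem_essNearSpectrum_of_const_norm_resolvent hε hU hne hsub hnorm hK' hS,
    starRingEnd ℂ z, ?_, Complex.conj_conj z⟩
  have hadj : ∀ w ∈ starRingEnd ℂ ⁻¹' U,
      IsResolventAt T.adjoint w (resolvent T (starRingEnd ℂ w)).adjoint := fun w hw => by
    simpa using (isResolventAt_resolvent (hsub hw)).adjoint hT
  refine mem_essNearSpectrum_of_const_norm_resolvent hε (U := starRingEnd ℂ ⁻¹' U)
    (hU.preimage Complex.continuous_conj) ?_ (fun w hw => ⟨_, hadj w hw⟩) (fun w hw => ?_)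
    hK'.adjoint (isResolventAt_adjoint_addBounded hT hS)
  · obtain ⟨w, hw⟩ := hne
    exact ⟨starRingEnd ℂ w, by simpa using hw⟩
  · rw [resolvent_eq (hadj w hw), LinearIsometryEquiv.norm_map]
    exact hnorm _ hw

end UnboundedOperator

theorem mainTheorem5
    {H₀ : Type*} [NormedAddCommGroup H₀] [InnerProductSpace ℂ H₀] [CompleteSpace H₀]
    [TopologicalSpace.SeparableSpace H₀] (hinf : ¬ FiniteDimensional ℂ H₀)
    (H : Submodule ℂ H₀) [CompleteSpace H]
    (T : H →ₗ.[ℂ] H) (hTclosed : T.IsClosed) (hTdense : Dense (T.domain : Set H))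
    (ε : ℝ) (hε : 0 < ε)
    (U : Set ℂ) (hUopen : IsOpen U) (hUne : U.Nonempty)
    (hUsub : U ⊆ UnboundedOperator.resolventSet T)
    (hUnorm : ∀ z ∈ U, ‖UnboundedOperator.resolvent T z‖ = 1 / ε) :
    UnboundedOperator.resolventSet T ⊆
      (⋂ (K : H →L[ℂ] H) (_ : IsCompactOperator K),
        UnboundedOperator.spectrum (UnboundedOperator.addBounded T K))ᶜ ∧
    (⋂ (K : H →L[ℂ] H) (_ : IsCompactOperator K),
        UnboundedOperator.spectrum (UnboundedOperator.addBounded T K))ᶜ ⊆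
      UnboundedOperator.essNearSpectrum ε T ∩
        UnboundedOperator.conjSet (UnboundedOperator.essNearSpectrum ε T.adjoint) ∧
    ∀ (Hn : ℕ → Submodule ℂ H₀) [∀ n, CompleteSpace (Hn n)]
      (Tn : ∀ n, Hn n →ₗ.[ℂ] Hn n),
      (∀ n, (Tn n).IsClosed) →
      (∀ n, Dense ((Tn n).domain : Set (Hn n))) →
      (∀ x : H₀, Tendsto (fun n => (Hn n).starProjection x) atTop (𝓝 (H.starProjection x))) →
      UnboundedOperator.GSRConverges Tn T →
      UnboundedOperator.GSRConverges (fun n => (Tn n).adjoint) T.adjoint →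
      (⋂ (K : H →L[ℂ] H) (_ : IsCompactOperator K),
          UnboundedOperator.spectrum (UnboundedOperator.addBounded T K))ᶜ ⊆
        UnboundedOperator.limEssNearSpectrum ε Tn ∩
          UnboundedOperator.conjSet
            (UnboundedOperator.limEssNearSpectrum ε (fun n => (Tn n).adjoint)) := by
  have hmain := UnboundedOperator.compl_iInter_spectrum_subset_essNearSpectrum hTdense hε hUopen
    hUne hUsub hUnorm
  refine ⟨fun z hz => ?_, hmain, ?_⟩
  · refine UnboundedOperator.mem_compl_iInter_spectrum_iff.2
      ⟨0, isCompactOperator_zero, ?_⟩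
    rwa [UnboundedOperator.addBounded_zero]
  · intro Hn _ Tn _ _ hP hconv hconv'
    exact hmain.trans (Set.inter_subset_inter
      (UnboundedOperator.essNearSpectrum_subset_limEssNearSpectrum hconv hP ε)
      (Set.image_mono (UnboundedOperator.essNearSpectrum_subset_limEssNearSpectrum hconv' hP ε)))
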